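/- Let $G=(V,E)$ be a finite undirected graph, where parallel edges and loops are allowed. In $\mathbb{R}^{|V|+|E|}$ with standard basis vectors $\mathbf{x}_v$ ($v\in V$) and $\mathbf{y}_e$ ($e\in E$), put, for an edge $e$ with ends $v,w$, $$p_e=-\mathbf{y}_e+\mathbf{x}_v+\mathbf{x}_w,\qquad p_{e,v}=\mathbf{y}_e+\mathbf{x}_v-\mathbf{x}_w,\qquad p_{e,w}=\mathbf{y}_e-\mathbf{x}_v+\mathbf{x}_w,$$ and let the cosmological polytope $P_G$ be the convex hull of all these points together with all $\mathbf{x}_v$, $v\in V$. Let $d>1$ and let $\sigma$ be a cycle of length $d$ in $G$, given by distinct nodes $v_1,\dots,v_d$ and distinct edges $e_1,\dots,e_d$, where $e_i$ has ends $v_i$ and $v_{i+1}$ (indices modulo $d$). Then the $2d$ points $$p_{e_1,v_1},\ p_{e_1,v_2},\ \dots,\ p_{e_d,v_d},\ p_{e_d,v_1}$$ are distinct, their convex hull $F_\sigma$ is a face of $P_G$ of dimension $2d-2$, and they are exactly the vertices of $F_\sigma$. Moreover, $F_\sigma$ is combinatorially equivalent (that is, its face lattice is isomorphic) to the cyclic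 polytope $C(2d,2d-2)$, the convex hull of $x(t_1),\dots,x(t_{2d})$ with $x(t)=(t,t^2,\dots,t^{2d-2})$, for every choice of real numbers $t_1<t_2<\dots<t_{2d}$. -/

import Mathlib

noncomputable section

namespace Cosmological

/-- The face poset of a polytope `P`, ordered by inclusion: the sets of points of `P` maximizing some
linear functional, together with the empty face. -/
abbrev FacePoset {M : Type*} [AddCommGroup M] [Module ℝ M] [TopologicalSpace M] (P : Set M) :
    Type _ :=
  {F : Set M // IsExposed ℝ P F}

/-- Two polytopes are combinatorially equivalent if their face posets are isomorphic. -/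
def CombEquiv {M N : Type*} [AddCommGroup M] [Module ℝ M] [TopologicalSpace M]
    [AddCommGroup N] [Module ℝ N] [TopologicalSpace N] (P : Set M) (Q : Set N) : Prop :=
  Nonempty (FacePoset P ≃o FacePoset Q)

/-- The moment curve `t ↦ (t, t², …, tᵐ)` in `ℝᵐ`. -/
def momentCurve (m : ℕ) (t : ℝ) : Fin m → ℝ := fun i => t ^ ((i : ℕ) + 1)

/-- The convex hull of the points with parameters `t 0, …, t (n - 1)` on the moment curve in `ℝᵐ`.
For strictly increasing `t` and `n > m` this is the cyclic polytope `C(n, m)`. -/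
def cyclicPolytope (m : ℕ) {n : ℕ} (t : Fin n → ℝ) : Set (Fin m → ℝ) :=
  convexHull ℝ (Set.range fun k => momentCurve m (t k))

variable {α β : Type*}

/-- The space `ℝ^(|V| + |E|)` of a multigraph (parallel edges and loops are allowed). -/
abbrev Space (G : Graph α β) : Type _ := (G.vertexSet ⊕ G.edgeSet) → ℝ

open Classical in
/-- The standard basis vector `𝐱_v`. -/
def xVec (G : Graph α β) (v : G.vertexSet) : Space G := Pi.single (Sum.inl v) 1

open Classical in
/-- The standard basis vector `𝐲_e`. -/
def yVec (G : Graph α β) (e : G.edgeSet) : Space G := Pi.single (Sum.inr e) 1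

/-- The point `p_e = -𝐲_e + 𝐱_v + 𝐱_w` of an edge `e` with ends `v` and `w`. -/
def edgePoint (G : Graph α β) (e : G.edgeSet) (v w : G.vertexSet) : Space G :=
  -yVec G e + xVec G v + xVec G w

/-- The point `p_{e,v} = 𝐲_e + 𝐱_v - 𝐱_w` of an edge `e` with ends `v` and `w`. -/
def endPoint (G : Graph α β) (e : G.edgeSet) (v w : G.vertexSet) : Space G :=
  yVec G e + xVec G v - xVec G w

/-- The cosmological polytope `P_G`. -/
def cosmologicalPolytope (G : Graph α β) : Set (Space G) :=
  convexHull ℝ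
    ({p | ∃ (e : G.edgeSet) (v w : G.vertexSet), G.IsLink (e : β) (v : α) (w : α) ∧
        (p = endPoint G e v w ∨ p = endPoint G e w v ∨ p = edgePoint G e v w)} ∪
      Set.range (xVec G))

/-- The points `p_{e_i,v_i}` and `p_{e_i,v_{i+1}}`, where `i` runs through `ℤ/dℤ`, for edges `e_i`
with ends `v_i` and `v_{i+1}`. -/
def cyclePoints (G : Graph α β) {d : ℕ} (v : ZMod d → G.vertexSet) (e : ZMod d → G.edgeSet) :
    Set (Space G) :=
  {p | ∃ i : ZMod d, p = endPoint G (e i) (v i) (v (i + 1)) ∨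
    p = endPoint G (e i) (v (i + 1)) (v i)}

end Cosmological

end

/-! Going once around the cycle, the differences `p_{e_i,v_i} - p_{e_i,v_{i+1}} = 2(x_{v_i} -
x_{v_{i+1}})` sum to zero. This is an affine dependency of the `2d` points with coefficients `±1`,
and it is the only one up to scaling: the points form an affine circuit.

For a circuit `c` the values of affine functionals at the points are exactly the vectors orthogonal
to `c`. Faces are therefore zero sets of nonnegative vectors `u` with `∑ c i * u i = 0`, and a
proper subset `S` is such a zero set iff its complement meets both signs of `c`
(`IsFaceSet.of_nonneg`, `IsFaceSet.exists_nonneg`). Hence the face poset depends only on the signs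
of `c` (`IsAffineCircuit.combEquiv`); vertices and dimension are read off from the circuit as well.

By Lagrange interpolation, `2d` points on the moment curve in dimension `2d - 2` also form a
circuit, with signs alternating along the curve. Both circuits have `d` coefficients of each sign,
so a relabelling matches them. Finally, the sum of the `y`-coordinates of the cycle edges is maximal
on `P_G` exactly on `F_σ`. -/

namespace Cosmological

/-! ### Faces, vertices and dimension of the convex hull of an affine circuit -/

section Circuit

variable {M N ι : Type*} [AddCommGroup M] [Module ℝ M] [TopologicalSpace M]
  [AddCommGroup N] [Module ℝ N] [TopologicalSpace N]

/-- The points of a convex hull where a linear functional attains an upper bound valid on the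
generators form the convex hull of the generators attaining it. -/
theorem sep_eq_convexHull_sep (A : Set M) (l : M →L[ℝ] ℝ) (b : ℝ) (h : ∀ a ∈ A, l a ≤ b) :
    {x ∈ convexHull ℝ A | l x = b} = convexHull ℝ {a ∈ A | l a = b} := by
  have hB : ∀ x ∈ convexHull ℝ {a ∈ A | l a = b}, l x = b := by
    have : convexHull ℝ {a ∈ A | l a = b} ⊆ {x | l x = b} :=
      convexHull_min (fun x hx => hx.2) (convex_hyperplane l.toLinearMap.isLinear b)
    exact this
  apply Set.Subset.antisymm
  · have hconv : Convex ℝ ({x | l x < b} ∪ convexHull ℝ {a ∈ A | l a = b}) := by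
      rw [convex_iff_forall_pos]
      have key : ∀ x ∈ {x | l x < b}, ∀ y ∈ {x | l x < b} ∪ convexHull ℝ {a ∈ A | l a = b},
          ∀ r s : ℝ, 0 < r → 0 < s → r + s = 1 → l (r • x + s • y) < b := by
        intro x hx y hy r s hr hs hrs
        have hy' : l y ≤ b := hy.elim (fun h => le_of_lt h) (fun h => (hB y h).le)
        have hx' : l x < b := hx
        simp only [map_add, map_smul, smul_eq_mul]
        calc r * l x + s * l y < r * b + s * b := by
              have := mul_lt_mul_of_pos_left hx' hr
              have := mul_le_mul_of_nonneg_left hy' hs.le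
              linarith
          _ = b := by rw [← add_mul, hrs, one_mul]
      intro x hx y hy r s hr hs hrs
      rcases hx with hx | hx
      · exact Or.inl (key x hx y hy r s hr hs hrs)
      rcases hy with hy | hy
      · left
        rw [add_comm]
        exact key y hy x (Or.inr hx) s r hs hr (by rw [add_comm, hrs])
      · exact Or.inr (convex_convexHull ℝ _ hx hy hr.le hs.le hrs)
    have hsub : convexHull ℝ A ⊆ {x | l x < b} ∪ convexHull ℝ {a ∈ A | l a = b} := by
      refine convexHull_min (fun a ha => ?_) hconv
      rcases (h a ha).lt_or_eq with h' | h'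
      · exact Or.inl h'
      · exact Or.inr (subset_convexHull ℝ _ ⟨ha, h'⟩)
    rintro x ⟨hx, hxb⟩
    rcases hsub hx with h' | h'
    · exact absurd hxb (ne_of_lt h')
    · exact h'
  · exact fun x hx => ⟨convexHull_mono (Set.sep_subset _ _) hx, hB x hx⟩

theorem isExposed_convexHull_sep (A : Set M) (l : M →L[ℝ] ℝ) (b : ℝ) (h : ∀ a ∈ A, l a ≤ b) :
    IsExposed ℝ (convexHull ℝ A) (convexHull ℝ {a ∈ A | l a = b}) := by
  rw [← sep_eq_convexHull_sep A l b h]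
  rintro ⟨z, hz, hzb⟩
  have hle : ∀ y ∈ convexHull ℝ A, l y ≤ b := by
    have : convexHull ℝ A ⊆ {x | l x ≤ b} :=
      convexHull_min h (convex_halfSpace_le l.toLinearMap.isLinear b)
    exact this
  refine ⟨l, Set.ext fun x => and_congr_right fun hx => ⟨fun hxb y hy => ?_, fun hmax => ?_⟩⟩
  · rw [hxb]; exact hle y hy
  · exact le_antisymm (hle x hx) (hzb ▸ hmax z hz)

variable [Fintype ι]

/-- `c` spans the space of affine dependencies of the points `p i`, and no `c i` vanishes. The
uniqueness of `c` is expressed dually: a vector orthogonal to `c` consists of the values of an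
affine functional at the points. -/
structure IsAffineCircuit (p : ι → M) (c : ι → ℝ) : Prop where
  ne_zero : ∀ i, c i ≠ 0
  sum_eq_zero : ∑ i, c i = 0
  sum_smul_eq_zero : ∑ i, c i • p i = 0
  exists_functional : ∀ u : ι → ℝ, ∑ i, c i * u i = 0 →
    ∃ (l : M →L[ℝ] ℝ) (b : ℝ), ∀ i, u i = b - l (p i)

/-- The sets of indices whose points span a face, for points with the affine dependency `c`. -/
def IsFaceSet (c : ι → ℝ) (S : Set ι) : Prop :=
  S = Set.univ ∨ (∃ i, i ∉ S ∧ 0 < c i) ∧ ∃ i, i ∉ S ∧ c i < 0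

/-- A vanishing sum with a nonzero term has terms of both signs, and since `u` is nonnegative the
sign of a nonzero term is that of its coefficient. -/
theorem IsFaceSet.of_nonneg {c u : ι → ℝ} (hc : ∀ i, c i ≠ 0) (hu : ∀ i, 0 ≤ u i)
    (h : ∑ i, c i * u i = 0) : IsFaceSet c {i | u i = 0} := by
  by_cases hS : {i | u i = 0} = Set.univ
  · exact Or.inl hS
  right
  obtain ⟨k, hk⟩ := (Set.ne_univ_iff_exists_notMem _).1 hS
  have hk0 : c k * u k ≠ 0 := mul_ne_zero (hc k) hk
  have hex : ∃ i ∈ Finset.univ, c i * u i ≠ 0 := ⟨k, Finset.mem_univ _, hk0⟩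
  have hneg : ∑ i, -(c i * u i) = 0 := by rw [Finset.sum_neg_distrib, h, neg_zero]
  obtain ⟨i, -, hi⟩ := Finset.exists_pos_of_sum_zero_of_exists_nonzero _ h hex
  obtain ⟨j, -, hj⟩ := Finset.exists_pos_of_sum_zero_of_exists_nonzero _ hneg
    ⟨k, Finset.mem_univ _, neg_ne_zero.2 hk0⟩
  refine ⟨⟨i, fun h0 => ?_, ?_⟩, j, fun h0 => ?_, ?_⟩
  · rw [show u i = 0 from h0, mul_zero] at hi; exact lt_irrefl _ hi
  · exact pos_of_mul_pos_left hi (hu i)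
  · rw [show u j = 0 from h0, mul_zero, neg_zero] at hj; exact lt_irrefl _ hj
  · exact neg_of_mul_neg_left (neg_pos.1 hj) (hu j)

theorem IsFaceSet.exists_nonneg {c : ι → ℝ} {S : Set ι} (hS : IsFaceSet c S) :
    ∃ u : ι → ℝ, (∀ i, 0 ≤ u i) ∧ ∑ i, c i * u i = 0 ∧ ∀ i, u i = 0 ↔ i ∈ S := by
  classical
  rcases hS with rfl | ⟨⟨a, haS, ha⟩, b, hbS, hb⟩
  · exact ⟨0, by simp, by simp, by simp⟩
  -- `P` and `Q` are the total positive and negative mass of `c` off `S`. Weighting positive indices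
  -- by `Q` and the others by `P` balances the sum as `P * Q - Q * P`.
  set P : ℝ := ∑ i, if i ∉ S ∧ 0 < c i then c i else 0 with hP
  set Q : ℝ := ∑ i, if i ∉ S ∧ ¬ 0 < c i then -c i else 0 with hQ
  have hP0 : 0 < P := by
    refine Finset.sum_pos' (fun i _ => ?_) ⟨a, Finset.mem_univ _, ?_⟩
    · split_ifs with h
      exacts [h.2.le, le_rfl]
    · rwa [if_pos ⟨haS, ha⟩]
  have hQ0 : 0 < Q := by
    refine Finset.sum_pos' (fun i _ => ?_) ⟨b, Finset.mem_univ _, ?_⟩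
    · split_ifs with h
      exacts [neg_nonneg.2 (not_lt.1 h.2), le_rfl]
    · rw [if_pos ⟨hbS, hb.not_gt⟩]; linarith
  refine ⟨fun i => if i ∈ S then 0 else if 0 < c i then Q else P, fun i => ?_, ?_, fun i => ?_⟩
  · dsimp only
    split_ifs
    exacts [le_rfl, hQ0.le, hP0.le]
  · have : ∀ i, c i * (if i ∈ S then 0 else if 0 < c i then Q else P) =
        (if i ∉ S ∧ 0 < c i then c i else 0) * Q -
          (if i ∉ S ∧ ¬ 0 < c i then -c i else 0) * P := by
      intro i
      by_cases h1 : i ∈ S <;> by_cases h2 : 0 < c i <;> simp [h1, h2]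
    rw [Finset.sum_congr rfl fun i _ => this i, Finset.sum_sub_distrib, ← Finset.sum_mul,
      ← Finset.sum_mul, ← hP, ← hQ]
    ring
  · by_cases h1 : i ∈ S
    · simp [h1]
    · by_cases h2 : 0 < c i <;> simp [h1, h2, hQ0.ne', hP0.ne']

namespace IsAffineCircuit

variable {p : ι → M} {c : ι → ℝ} (hc : IsAffineCircuit p c)
include hc

theorem sum_mul_functional (l : M →L[ℝ] ℝ) (b : ℝ) : ∑ i, c i * (b - l (p i)) = 0 := by
  have h := congrArg l hc.sum_smul_eq_zero
  simp only [map_sum, map_smul, smul_eq_mul, map_zero] at h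
  simp only [mul_sub, Finset.sum_sub_distrib, h, ← Finset.sum_mul, hc.sum_eq_zero, zero_mul,
    sub_zero]

theorem exists_supporting {S : Set ι} (hS : IsFaceSet c S) :
    ∃ (l : M →L[ℝ] ℝ) (b : ℝ), (∀ i, l (p i) ≤ b) ∧ ∀ i, l (p i) = b ↔ i ∈ S := by
  obtain ⟨u, hu, hsum, hz⟩ := hS.exists_nonneg
  obtain ⟨l, b, hl⟩ := hc.exists_functional u hsum
  refine ⟨l, b, fun i => ?_, fun i => ?_⟩
  · have := hu i
    rw [hl i] at this
    linarith
  · rw [← hz i, hl i, sub_eq_zero, eq_comm]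

theorem isExposed_convexHull_image {S : Set ι} (hS : IsFaceSet c S) :
    IsExposed ℝ (convexHull ℝ (Set.range p)) (convexHull ℝ (p '' S)) := by
  obtain ⟨l, b, hle, heq⟩ := hc.exists_supporting hS
  have h : p '' S = {a ∈ Set.range p | l a = b} := by
    ext a
    constructor
    · rintro ⟨i, hi, rfl⟩
      exact ⟨⟨i, rfl⟩, (heq i).2 hi⟩
    · rintro ⟨⟨i, rfl⟩, hi⟩
      exact ⟨i, (heq i).1 hi, rfl⟩
  rw [h]
  exact isExposed_convexHull_sep _ l b (by rintro _ ⟨i, rfl⟩; exact hle i)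

theorem mem_convexHull_image_iff {S : Set ι} (hS : IsFaceSet c S) (i : ι) :
    p i ∈ convexHull ℝ (p '' S) ↔ i ∈ S := by
  refine ⟨fun hi => ?_, fun hi => subset_convexHull ℝ _ ⟨i, hi, rfl⟩⟩
  obtain ⟨l, b, -, heq⟩ := hc.exists_supporting hS
  have : convexHull ℝ (p '' S) ⊆ {x | l x = b} := by
    refine convexHull_min ?_ (convex_hyperplane l.toLinearMap.isLinear b)
    rintro _ ⟨j, hj, rfl⟩
    exact (heq j).2 hj
  exact (heq i).1 (this hi)

theorem isFaceSet_empty [Nonempty ι] : IsFaceSet c ∅ := by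
  -- The constant `1` has empty zero set, and its orthogonality to `c` is `∑ c i = 0`.
  have h := IsFaceSet.of_nonneg (u := fun _ => 1) hc.ne_zero (by simp)
    (by simpa using hc.sum_eq_zero)
  simpa using h

theorem exists_isFaceSet [Nonempty ι] {B : Set M}
    (hB : IsExposed ℝ (convexHull ℝ (Set.range p)) B) :
    ∃ S, IsFaceSet c S ∧ convexHull ℝ (p '' S) = B := by
  rcases B.eq_empty_or_nonempty with rfl | hne
  · exact ⟨∅, hc.isFaceSet_empty, by simp⟩
  obtain ⟨l, hl⟩ := hB hne
  obtain ⟨x, hx⟩ := hne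
  rw [hl] at hx
  have hle : ∀ i, l (p i) ≤ l x := fun i => hx.2 _ (subset_convexHull ℝ _ ⟨i, rfl⟩)
  refine ⟨{i | l x - l (p i) = 0}, IsFaceSet.of_nonneg hc.ne_zero
    (fun i => sub_nonneg.2 (hle i)) (hc.sum_mul_functional l (l x)), ?_⟩
  have h : p '' {i | l x - l (p i) = 0} = {a ∈ Set.range p | l a = l x} := by
    ext a
    constructor
    · rintro ⟨i, hi, rfl⟩
      exact ⟨⟨i, rfl⟩, (sub_eq_zero.1 hi).symm⟩
    · rintro ⟨⟨i, rfl⟩, hi⟩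
      exact ⟨i, sub_eq_zero.2 hi.symm, rfl⟩
  rw [h, ← sep_eq_convexHull_sep _ l (l x) (by rintro _ ⟨i, rfl⟩; exact hle i), hl]
  ext y
  refine and_congr_right fun hy => ⟨fun hyx z hz => hyx ▸ hx.2 z hz, fun hmax => ?_⟩
  exact le_antisymm (hx.2 y hy) (hmax x hx.1)

/-- The face poset of the convex hull of an affine circuit is the poset of its face sets. -/
theorem nonempty_orderIso [Nonempty ι] :
    Nonempty ({S : Set ι // IsFaceSet c S} ≃o FacePoset (convexHull ℝ (Set.range p))) := by
  let f : {S : Set ι // IsFaceSet c S} → FacePoset (convexHull ℝ (Set.range p)) :=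
    fun S => ⟨convexHull ℝ (p '' S.1), hc.isExposed_convexHull_image S.2⟩
  have hf : ∀ S T, f S ≤ f T ↔ S ≤ T := by
    intro S T
    refine ⟨fun h i hi => ?_, fun h => convexHull_mono (Set.image_mono h)⟩
    exact (hc.mem_convexHull_image_iff T.2 i).1 (h (subset_convexHull ℝ _ ⟨i, hi, rfl⟩))
  refine ⟨RelIso.ofSurjective (OrderEmbedding.ofMapLEIff f hf) fun B => ?_⟩
  obtain ⟨S, hS, h⟩ := hc.exists_isFaceSet B.2
  exact ⟨⟨S, hS⟩, Subtype.ext h⟩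

theorem combEquiv [Nonempty ι] {q : ι → N} {c' : ι → ℝ} (hc' : IsAffineCircuit q c')
    (h : ∀ i, 0 < c i ↔ 0 < c' i) :
    CombEquiv (convexHull ℝ (Set.range p)) (convexHull ℝ (Set.range q)) := by
  have hneg : ∀ i, c i < 0 ↔ c' i < 0 := fun i => by
    have h1 := (hc.ne_zero i).lt_or_gt
    have h2 := (hc'.ne_zero i).lt_or_gt
    have h3 := h i
    constructor
    · intro h4
      exact h2.resolve_right fun h5 => lt_asymm h4 (h3.2 h5)
    · intro h4
      exact h1.resolve_right fun h5 => lt_asymm h4 (h3.1 h5)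
  have hS : IsFaceSet c = IsFaceSet c' := by
    funext S
    simp only [IsFaceSet, h, hneg]
  obtain ⟨f⟩ := hc.nonempty_orderIso
  obtain ⟨g⟩ := hc'.nonempty_orderIso
  rw [hS] at f
  exact ⟨f.symm.trans g⟩

theorem injective (hpos : ∀ k, IsFaceSet c {k}) : Function.Injective p := by
  intro i j hij
  refine (hc.mem_convexHull_image_iff (hpos j) i).1 ?_
  rw [hij]
  exact subset_convexHull ℝ _ ⟨j, rfl, rfl⟩

theorem extremePoints_convexHull (hpos : ∀ k, IsFaceSet c {k}) :
    Set.extremePoints ℝ (convexHull ℝ (Set.range p)) = Set.range p := by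
  refine Set.Subset.antisymm extremePoints_convexHull_subset ?_
  rintro _ ⟨i, rfl⟩
  have h := hc.isExposed_convexHull_image (hpos i)
  rw [Set.image_singleton, convexHull_singleton] at h
  exact isExtreme_singleton.1 h.isExtreme

/-- A dependency avoiding `k` would be a multiple of `c` vanishing at `k`, hence zero. -/
theorem affineIndependent_ne (k : ι) : AffineIndependent ℝ fun i : {i // i ≠ k} => p i := by
  classical
  rw [affineIndependent_iff]
  intro s w hw hwp j hj
  -- This vector is orthogonal to `c` and, away from `k`, is supported at `j`. Pairing its
  -- functional with the dependency `w` isolates `w j * c k`.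
  obtain ⟨l, b, hl⟩ := hc.exists_functional (Pi.single (j : ι) (c k) - Pi.single k (c j)) (by
    simp [mul_sub, Finset.sum_sub_distrib, Pi.single_apply, mul_comm])
  have h := congrArg l hwp
  simp only [map_sum, map_smul, smul_eq_mul, map_zero] at h
  have h0 : ∑ i ∈ s, w i * (b - l (p i)) = 0 := by
    simp only [mul_sub, Finset.sum_sub_distrib, h, ← Finset.sum_mul, hw, zero_mul, sub_zero]
  rw [Finset.sum_eq_single_of_mem j hj, ← hl] at h0
  · simpa [Pi.single_apply, j.2, hc.ne_zero k] using h0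
  · intro i _ hij
    rw [← hl]
    simp [i.2, Subtype.coe_injective.ne hij]

/-- The dependency `c` bounds the dimension above by `m`; the `m + 1` independent points left after
deleting one bound it below. -/
theorem finrank_vectorSpan {m : ℕ} (hm : Fintype.card ι = m + 2) :
    Module.finrank ℝ (vectorSpan ℝ (convexHull ℝ (Set.range p))) = m := by
  classical
  have hspan : vectorSpan ℝ (convexHull ℝ (Set.range p)) = vectorSpan ℝ (Set.range p) := by
    rw [← direction_affineSpan, affineSpan_convexHull, direction_affineSpan]
  rw [hspan]
  have : Nonempty ι := Fintype.card_pos_iff.1 (by omega)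
  obtain ⟨k⟩ := this
  apply le_antisymm
  · rw [finrank_vectorSpan_le_iff_not_affineIndependent ℝ p hm, affineIndependent_iff]
    intro h
    exact hc.ne_zero k (h Finset.univ c hc.sum_eq_zero hc.sum_smul_eq_zero k (Finset.mem_univ k))
  · have hcard : Fintype.card {i // i ≠ k} = m + 1 := by
      rw [Fintype.card_subtype_compl, Fintype.card_subtype_eq, hm]
      rfl
    rw [← (hc.affineIndependent_ne k).finrank_vectorSpan hcard]
    have : FiniteDimensional ℝ (vectorSpan ℝ (Set.range p)) :=
      finiteDimensional_vectorSpan_of_finite ℝ (Set.finite_range p)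
    refine Submodule.finrank_mono (vectorSpan_mono ℝ ?_)
    rintro _ ⟨i, rfl⟩
    exact ⟨i, rfl⟩

end IsAffineCircuit

end Circuit

/-! ### The alternating circuit on the moment curve -/

section MomentCurve

open Polynomial

variable {n : ℕ}

/-- The coefficients of the affine dependency of `n` points on the moment curve in `ℝ^(n - 2)`. -/
noncomputable def momentWeight (t : Fin n → ℝ) (k : Fin n) : ℝ := (∏ j ∈ Finset.univ.erase k, (t k - t j))⁻¹

/-- Interpolation at `n` nodes is exact in degree below `n`; this compares coefficients of `X ^ (n -
1)`. The sum vanishes precisely when the degree is below `n - 1`, which gives both the dependency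
and its uniqueness. -/
theorem sum_momentWeight_mul_eval {t : Fin n → ℝ} (ht : Function.Injective t) {P : ℝ[X]}
    (hP : P.degree < n) : ∑ k, momentWeight t k * P.eval (t k) = P.coeff (n - 1) := by
  have h := Lagrange.coeff_eq_sum (s := Finset.univ) (v := t) ht.injOn (P := P) (by simpa using hP)
  rw [Finset.card_univ, Fintype.card_fin] at h
  rw [h]
  exact Finset.sum_congr rfl fun k _ => by rw [momentWeight, div_eq_inv_mul]

theorem sum_momentWeight_mul_pow {t : Fin n → ℝ} (ht : Function.Injective t) {m : ℕ}
    (hm : m + 1 < n) : ∑ k, momentWeight t k * t k ^ m = 0 := by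
  have h := sum_momentWeight_mul_eval ht (P := X ^ m) (by
    rw [degree_X_pow]; exact_mod_cast (Nat.lt_of_succ_lt hm))
  simp only [eval_pow, eval_X] at h
  rw [h, coeff_X_pow, if_neg (by omega)]

/-- The factor `t k - t j` is negative exactly for the `n - 1 - k` indices `j` above `k`. -/
theorem momentWeight_pos_iff {t : Fin n → ℝ} (ht : StrictMono t) (k : Fin n) :
    0 < momentWeight t k ↔ Even (n - 1 - k) := by
  have hpos : 0 < ∏ j ∈ Finset.univ.erase k, ((t k - t j) * if k < j then -1 else 1) := by
    refine Finset.prod_pos fun j hj => ?_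
    rcases lt_or_gt_of_ne (Finset.ne_of_mem_erase hj) with h | h
    · rw [if_neg h.not_gt]
      linarith [ht h]
    · rw [if_pos h]
      linarith [ht h]
  have hcard : (Finset.filter (fun j => k < j) (Finset.univ.erase k)) = Finset.Ioi k := by
    ext j
    simp only [Finset.mem_filter, Finset.mem_erase, Finset.mem_univ, and_true, Finset.mem_Ioi]
    exact ⟨fun h => h.2, fun h => ⟨h.ne', h⟩⟩
  rw [Finset.prod_mul_distrib, Finset.prod_ite, Finset.prod_const_one, mul_one, Finset.prod_const,
    hcard, Fin.card_Ioi] at hpos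
  rw [momentWeight, inv_pos]
  rcases Nat.even_or_odd (n - 1 - k) with h | h
  · rw [h.neg_one_pow, mul_one] at hpos
    exact iff_of_true hpos h
  · rw [h.neg_one_pow] at hpos
    exact iff_of_false (by linarith) (Nat.not_even_iff_odd.2 h)

theorem isAffineCircuit_momentCurve {m : ℕ} (hn : n = m + 2) {t : Fin n → ℝ}
    (ht : Function.Injective t) :
    IsAffineCircuit (fun k => momentCurve m (t k)) (momentWeight t) where
  ne_zero k := inv_ne_zero (Finset.prod_ne_zero_iff.2 fun j hj =>
    sub_ne_zero.2 (ht.ne (Finset.ne_of_mem_erase hj).symm))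
  sum_eq_zero := by
    simpa using sum_momentWeight_mul_pow ht (m := 0) (by omega)
  sum_smul_eq_zero := by
    ext i
    simp only [Finset.sum_apply, Pi.smul_apply, smul_eq_mul, momentCurve, Pi.zero_apply]
    exact sum_momentWeight_mul_pow ht (by omega)
  exists_functional u hu := by
    -- Orthogonality of `u` to the weights kills the coefficient of `X ^ (m + 1)` in the interpolant
    -- of `u`. What remains has degree at most `m`, so it is an affine functional on the moment
    -- curve.
    set Q : ℝ[X] := Lagrange.interpolate Finset.univ t u with hQ
    have hdeg : Q.degree < n := by
      have h := Lagrange.degree_interpolate_lt (s := Finset.univ) u ht.injOn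
      rwa [Finset.card_univ, Fintype.card_fin] at h
    have heval : ∀ k, Q.eval (t k) = u k := fun k =>
      Lagrange.eval_interpolate_at_node u ht.injOn (Finset.mem_univ k)
    have hcoeff : Q.coeff (m + 1) = 0 := by
      have h := sum_momentWeight_mul_eval ht hdeg
      simp only [heval] at h
      rw [← hu, h, hn]
      rfl
    have hnat : Q.natDegree < m + 1 := by
      rw [Nat.lt_succ_iff, natDegree_le_iff_coeff_eq_zero]
      intro N hN
      rcases (Nat.succ_le_of_lt hN).eq_or_lt with h | h
      · rw [← h]; exact hcoeff
      · exact coeff_eq_zero_of_degree_lt (hdeg.trans_le (by exact_mod_cast (by omega : n ≤ N)))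
    refine ⟨-∑ i : Fin m, Q.coeff (i + 1) • ContinuousLinearMap.proj (R := ℝ) i, Q.coeff 0,
      fun k => ?_⟩
    rw [← heval k, eval_eq_sum_range' hnat, Finset.sum_range_succ', Finset.sum_range]
    simp [momentCurve, add_comm]

end MomentCurve

/-! ### The circuit of a cycle in the graph and its supporting hyperplane -/

section Cycle

variable {α β : Type*} {G : Graph α β} {d : ℕ}

/-- Negated partial sums of `w` work; the vanishing total is what closes the cycle. -/
theorem exists_potential [NeZero d] (w : ZMod d → ℝ) (hw : ∑ i, w i = 0) :
    ∃ x : ZMod d → ℝ, ∀ i, x i - x (i + 1) = w i := by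
  have hsum : ∑ k ∈ Finset.range d, w k = 0 := by
    rw [← hw]
    refine Finset.sum_nbij' (fun k => (k : ZMod d)) ZMod.val (by simp) (fun i _ => ?_)
      (fun k hk => ?_) (by simp) (by simp)
    · exact Finset.mem_range.2 (ZMod.val_lt i)
    · exact ZMod.val_natCast_of_lt (Finset.mem_range.1 hk)
  refine ⟨fun i => -∑ k ∈ Finset.range i.val, w k, fun i => ?_⟩
  have hi : ((i.val : ℕ) : ZMod d) = i := ZMod.natCast_zmod_val i
  have hcast : i + 1 = ((i.val + 1 : ℕ) : ZMod d) := by rw [Nat.cast_add, hi, Nat.cast_one]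
  rcases (Nat.succ_le_of_lt (ZMod.val_lt i)).lt_or_eq with h | h
  · dsimp only
    rw [hcast, ZMod.val_natCast_of_lt (show i.val + 1 < d from h), Finset.sum_range_succ, hi]
    ring
  -- The wrap-around `i.val = d - 1`, where `i + 1 = 0`.
  · have hrange : Finset.range d = Finset.range (i.val + 1) := congrArg Finset.range h.symm
    rw [hrange, Finset.sum_range_succ, hi] at hsum
    have h0 : i + 1 = 0 := by
      rw [hcast]
      exact (congrArg _ h).trans (ZMod.natCast_self d)
    dsimp only
    rw [h0, ZMod.val_zero, Finset.sum_range_zero]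
    linarith

/-- The points of a cycle, indexed by an edge and one of its two ends. -/
noncomputable def cyclePoint (v : ZMod d → G.vertexSet) (e : ZMod d → G.edgeSet)
    (k : ZMod d × Bool) : Space G :=
  bif k.2 then endPoint G (e k.1) (v k.1) (v (k.1 + 1))
  else endPoint G (e k.1) (v (k.1 + 1)) (v k.1)

/-- The coefficients of the affine dependency of the points of a cycle. -/
noncomputable def cycleSign (k : ZMod d × Bool) : ℝ := bif k.2 then 1 else -1

theorem range_cyclePoint (v : ZMod d → G.vertexSet) (e : ZMod d → G.edgeSet) :
    Set.range (cyclePoint v e) = cyclePoints G v e := by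
  ext p
  constructor
  · rintro ⟨⟨i, b⟩, rfl⟩
    cases b
    exacts [⟨i, Or.inr rfl⟩, ⟨i, Or.inl rfl⟩]
  · rintro ⟨i, rfl | rfl⟩
    exacts [⟨(i, true), rfl⟩, ⟨(i, false), rfl⟩]

theorem isAffineCircuit_cyclePoint [NeZero d] {v : ZMod d → G.vertexSet} {e : ZMod d → G.edgeSet}
    (hv : Function.Injective v) (he : Function.Injective e) :
    IsAffineCircuit (cyclePoint v e) cycleSign where
  ne_zero := by rintro ⟨i, _ | _⟩ <;> simp [cycleSign]
  sum_eq_zero := by simp [cycleSign, Fintype.sum_prod_type]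
  sum_smul_eq_zero := by
    have h : ∑ i, xVec G (v (i + 1)) = ∑ i, xVec G (v i) :=
      Equiv.sum_comp (Equiv.addRight (1 : ZMod d)) fun i => xVec G (v i)
    simp only [Fintype.sum_prod_type, Fintype.sum_bool, cycleSign, cyclePoint, cond_true,
      cond_false, one_smul, neg_smul, endPoint, neg_sub, Finset.sum_add_distrib,
      Finset.sum_sub_distrib, h]
    abel
  exists_functional u hu := by
    -- With `b = 0`, the prescribed values at the two points of `e i` read `u = -(y i ± (x i - x (i
    -- + 1)))`. Half-sums determine `y i`; half-differences determine the increments of `x`, which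
    -- sum to zero around the cycle.
    have hu' : ∑ i : ZMod d, -((u (i, true) - u (i, false)) / 2) = 0 := by
      simp only [Fintype.sum_prod_type, Fintype.sum_bool, cycleSign, cond_true, cond_false,
        one_mul, neg_one_mul] at hu
      rw [Finset.sum_neg_distrib, ← Finset.sum_div]
      simp only [sub_eq_add_neg, hu, zero_div, neg_zero]
    obtain ⟨x, hx⟩ := exists_potential _ hu'
    let l : Space G →L[ℝ] ℝ :=
      ∑ i, (x i • ContinuousLinearMap.proj (R := ℝ) (Sum.inl (v i)) +
        (-(u (i, true) + u (i, false)) / 2) • ContinuousLinearMap.proj (R := ℝ) (Sum.inr (e i)))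
    have hlx : ∀ i, l (xVec G (v i)) = x i := fun i => by
      simp [l, xVec, Pi.single_apply, hv.eq_iff]
    have hly : ∀ i, l (yVec G (e i)) = -(u (i, true) + u (i, false)) / 2 := fun i => by
      simp [l, yVec, Pi.single_apply, he.eq_iff]
    refine ⟨l, 0, ?_⟩
    rintro ⟨i, _ | _⟩ <;>
    · simp only [cyclePoint, cond_true, cond_false, endPoint, map_add, map_sub, hlx, hly]
      linarith [hx i]

/-- Since `d > 1` there is another edge, whose two points carry opposite signs. -/
theorem isFaceSet_cycleSign_singleton (hd : 1 < d) (k : ZMod d × Bool) :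
    IsFaceSet cycleSign {k} := by
  have : Fact (1 < d) := ⟨hd⟩
  obtain ⟨j, hj⟩ := exists_ne k.1
  refine Or.inr ⟨⟨(j, true), fun h => hj (congrArg Prod.fst h), by simp [cycleSign]⟩,
    (j, false), fun h => hj (congrArg Prod.fst h), by simp [cycleSign]⟩

theorem isExposed_convexHull_cyclePoints [NeZero d] {v : ZMod d → G.vertexSet}
    {e : ZMod d → G.edgeSet} (hlink : ∀ i, G.IsLink (e i : β) (v i : α) (v (i + 1) : α))
    (he : Function.Injective e) :
    IsExposed ℝ (cosmologicalPolytope G) (convexHull ℝ (cyclePoints G v e)) := by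
  classical
  -- On the generators, this functional is `1` at `p_{e,v}` and `-1` at `p_e` for cycle edges `e`,
  -- and `0` elsewhere.
  let l : Space G →L[ℝ] ℝ := ∑ i, ContinuousLinearMap.proj (R := ℝ) (Sum.inr (e i))
  have hlx : ∀ a, l (xVec G a) = 0 := fun a => by
    simp [l, xVec]
  have hly : ∀ i, l (yVec G (e i)) = 1 := fun i => by
    simp [l, yVec, Pi.single_apply, he.eq_iff]
  have hly' : ∀ f, (∀ i, e i ≠ f) → l (yVec G f) = 0 := fun f hf => by
    simp [l, yVec, hf]
  have hend : ∀ f a b, l (endPoint G f a b) = l (yVec G f) := fun f a b => by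
    simp [endPoint, hlx]
  have hedge : ∀ f a b, l (edgePoint G f a b) = -l (yVec G f) := fun f a b => by
    simp [edgePoint, hlx]
  have hle : ∀ f, l (yVec G f) ≤ 1 ∧ -l (yVec G f) < 1 := fun f => by
    by_cases hf : ∃ i, e i = f
    · obtain ⟨i, rfl⟩ := hf
      rw [hly]; norm_num
    · rw [hly' f (not_exists.1 hf)]; norm_num
  have hmem : ∀ (f : G.edgeSet) (a b : G.vertexSet), G.IsLink (f : β) (a : α) (b : α) → l (yVec G f) = 1 →
      endPoint G f a b ∈ cyclePoints G v e := by
    intro f a b hab hf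
    obtain ⟨i, rfl⟩ : ∃ i, e i = f := by
      by_contra h
      rw [hly' f (not_exists.1 h)] at hf
      exact zero_ne_one hf
    rcases hab.eq_and_eq_or_eq_and_eq (hlink i) with ⟨h1, h2⟩ | ⟨h1, h2⟩ <;>
      rw [Subtype.ext h1, Subtype.ext h2]
    exacts [⟨i, Or.inl rfl⟩, ⟨i, Or.inr rfl⟩]
  unfold cosmologicalPolytope
  set A := {p | ∃ (e : G.edgeSet) (v w : G.vertexSet), G.IsLink (e : β) (v : α) (w : α) ∧
        (p = endPoint G e v w ∨ p = endPoint G e w v ∨ p = edgePoint G e v w)} ∪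
      Set.range (xVec G) with hA
  have hbound : ∀ a ∈ A, l a ≤ 1 := by
    rintro _ (⟨f, a, b, -, rfl | rfl | rfl⟩ | ⟨a, rfl⟩)
    · rw [hend]; exact (hle f).1
    · rw [hend]; exact (hle f).1
    · rw [hedge]; exact (hle f).2.le
    · rw [hlx]; exact zero_le_one
  have hsep : cyclePoints G v e = {a ∈ A | l a = 1} := by
    ext p
    constructor
    · rintro ⟨i, rfl | rfl⟩
      · exact ⟨Or.inl ⟨e i, _, _, hlink i, Or.inl rfl⟩, by rw [hend, hly]⟩
      · exact ⟨Or.inl ⟨e i, _, _, hlink i, Or.inr (Or.inl rfl)⟩, by rw [hend, hly]⟩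
    · rintro ⟨⟨f, a, b, hab, rfl | rfl | rfl⟩ | ⟨a, rfl⟩, h1⟩
      · exact hmem f a b hab (by rw [← h1, hend])
      · exact hmem f b a hab.symm (by rw [← h1, hend])
      · rw [hedge] at h1; exact absurd h1 (hle f).2.ne
      · rw [hlx] at h1; exact absurd h1 zero_ne_one
  rw [hsep]
  exact isExposed_convexHull_sep A l 1 hbound

/-- Listing the points edge by edge, negative before positive, puts the positive ones at the odd
positions, where `2 * d - 1 - k` is even. -/
theorem exists_cycle_equiv_fin [NeZero d] :
    ∃ f : ZMod d × Bool ≃ Fin (2 * d), ∀ k, 0 < (cycleSign k) ↔ Even (2 * d - 1 - f k) := by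
  let f : ZMod d × Bool → Fin (2 * d) := fun k => ⟨2 * k.1.val + k.2.toNat, by
    have := ZMod.val_lt k.1
    have := Bool.toNat_lt k.2
    omega⟩
  have hinj : Function.Injective f := by
    rintro ⟨i, a⟩ ⟨j, b⟩ h
    have h' : 2 * i.val + a.toNat = 2 * j.val + b.toNat := congrArg Fin.val h
    have hij : i.val = j.val := by
      have := Bool.toNat_lt a
      have := Bool.toNat_lt b
      omega
    have hab : a.toNat = b.toNat := by omega
    have hab' : a = b := by
      cases a <;> cases b <;> simp_all
    rw [ZMod.val_injective d hij, hab']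
  have hbij : Function.Bijective f := by
    rw [Fintype.bijective_iff_injective_and_card]
    exact ⟨hinj, by simp [ZMod.card, mul_comm]⟩
  refine ⟨Equiv.ofBijective f hbij, ?_⟩
  rintro ⟨i, b⟩
  have hi := ZMod.val_lt i
  cases b
  · refine iff_of_false (by norm_num [cycleSign]) (Nat.not_even_iff.2 ?_)
    change (2 * d - 1 - (2 * i.val + 0)) % 2 = 1
    omega
  · refine iff_of_true (by norm_num [cycleSign]) (Nat.even_iff.2 ?_)
    change (2 * d - 1 - (2 * i.val + 1)) % 2 = 0
    omega

end Cycle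

theorem IsAffineCircuit.comp_equiv {M ι κ : Type*} [AddCommGroup M] [Module ℝ M]
    [TopologicalSpace M] [Fintype ι] [Fintype κ] {p : κ → M} {c : κ → ℝ}
    (hc : IsAffineCircuit p c) (f : ι ≃ κ) : IsAffineCircuit (p ∘ f) (c ∘ f) where
  ne_zero i := hc.ne_zero (f i)
  sum_eq_zero := (Equiv.sum_comp f c).trans hc.sum_eq_zero
  sum_smul_eq_zero := (Equiv.sum_comp f fun k => c k • p k).trans hc.sum_smul_eq_zero
  exists_functional u hu := by
    obtain ⟨l, b, h⟩ := hc.exists_functional (u ∘ f.symm) (by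
      rw [← hu, ← Equiv.sum_comp f]
      simp)
    exact ⟨l, b, fun i => by simpa using h (f i)⟩

end Cosmological

open Cosmological in
theorem proposition3p6 {α β : Type*} (G : Graph α β) (hV : G.vertexSet.Finite)
    (hE : G.edgeSet.Finite) (d : ℕ) (hd : 1 < d)
    (v : ZMod d → G.vertexSet) (e : ZMod d → G.edgeSet)
    (hlink : ∀ i : ZMod d, G.IsLink (e i : β) (v i : α) (v (i + 1) : α))
    (hv : Function.Injective v) (he : Function.Injective e) :
    ∃ F : Set (Cosmological.Space G),
      IsExposed ℝ (Cosmological.cosmologicalPolytope G) F ∧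
      F = convexHull ℝ (Cosmological.cyclePoints G v e) ∧
      Set.extremePoints ℝ F = Cosmological.cyclePoints G v e ∧
      (Cosmological.cyclePoints G v e).ncard = 2 * d ∧
      Module.finrank ℝ (vectorSpan ℝ F) = 2 * d - 2 ∧
      ∀ t : Fin (2 * d) → ℝ, StrictMono t →
        Cosmological.CombEquiv F (Cosmological.cyclicPolytope (2 * d - 2) t) := by
  have : NeZero d := ⟨by omega⟩
  have hc := isAffineCircuit_cyclePoint hv he
  have hcard : Fintype.card (ZMod d × Bool) = 2 * d := by simp [ZMod.card, mul_comm]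
  have hsingle := isFaceSet_cycleSign_singleton hd
  refine ⟨_, isExposed_convexHull_cyclePoints hlink he, rfl, ?_, ?_, ?_, fun t ht => ?_⟩
  · rw [← range_cyclePoint]
    exact hc.extremePoints_convexHull hsingle
  · rw [← range_cyclePoint, ← Set.image_univ, Set.ncard_image_of_injective _ (hc.injective hsingle),
      Set.ncard_univ, Nat.card_eq_fintype_card, hcard]
  · rw [← range_cyclePoint]
    exact hc.finrank_vectorSpan (by omega)
  · obtain ⟨f, hf⟩ := exists_cycle_equiv_fin (d := d)
    have hm := (isAffineCircuit_momentCurve (m := 2 * d - 2) (by omega) ht.injective).comp_equiv f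
    have h := hc.combEquiv hm fun k => (hf k).trans (momentWeight_pos_iff ht (f k)).symm
    rwa [range_cyclePoint, f.surjective.range_comp] at h
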